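/- All graphs are finite and simple. Let $G=(V,E)$ be a connected graph with edge weights $c\in\mathbb{R}_{>0}^{E}$. For $e\in E$ the relative resistance is $$r_e(c)=\frac{\sum_{T\ni e}\prod_{t\in T}c_t}{\sum_{T}\prod_{t\in T}c_t},$$ where $T$ runs over the spanning trees (maximal acyclic edge sets) of $G$, and the resistance curvature at $v\in V$ is $p_v(c)=1-\tfrac12\sum_{uv\in E}r_{uv}(c)$. A graph is resistance nonnegative (RN) if it has some positive edge weights for which $p_v\ge 0$ at every vertex $v$, and resistance positive (RP) if it has some positive edge weights for which $p_v>0$ at every vertex $v$. If $p_v(c)\ge 0$ for all $v\in V$ and $x\in V$, the circle inversion $\operatorname{cinv}_x(G,c)$ is the graph obtained from $G$ by removing $x$ and adding a new vertex $\hat x$ that is adjacent to exactly those $y\in V\setminus\{x\}$ with $p_y(c)>0$ (curvature taken in $G$ with weights $c$). **Proposition.** Let $G$ be a finite connected graph which is RN, let $c$ be any positive edge weights with $p_v(c)\ge 0$ for all $v\in V$, and let $x\in V$. Then $\operatorname{cinv}_x(G,c)$ is connected and RN. If moreover $p_x(c)>0$ and $x$ is adjacent in $G$ to all other vertices, then $\operatorname{cinv}_x(G,c)$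 is RP. -/

import Mathlib

/-!
Finite simple graphs with edge weights. A weight function is a function `c : Sym2 V → ℝ`; only its
values on the edges of the graph matter. All finite sums below use classical decidability.
-/

namespace ResistanceGraph

section

open Classical

variable {V : Type*}

/-- A set of edges of `G` without cycles. -/
def IsAcyclicEdgeSet (G : SimpleGraph V) (T : Finset (Sym2 V)) : Prop :=
  (∀ e ∈ T, e ∈ G.edgeSet) ∧ (SimpleGraph.fromEdgeSet (T : Set (Sym2 V))).IsAcyclic

/-- A spanning tree of `G`: an inclusion-maximal acyclic set of edges of `G`. -/
def IsSpanningTree (G : SimpleGraph V) (T : Finset (Sym2 V)) : Prop :=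
  Maximal (IsAcyclicEdgeSet G) T

/-- The finite set of all spanning trees of `G`. -/
noncomputable def spanningTrees [Fintype V] (G : SimpleGraph V) : Finset (Finset (Sym2 V)) :=
  Finset.univ.filter fun T => IsSpanningTree G T

/-- Finite positive weights on the edges of `G`. -/
def IsPositiveWeight (G : SimpleGraph V) (c : Sym2 V → ℝ) : Prop :=
  ∀ e ∈ G.edgeSet, 0 < c e

/-- The relative resistance `r_e(c)` of an edge `e`: the `c`-weighted fraction of the spanning
trees of `G` that contain `e`. -/
noncomputable def relativeResistance [Fintype V] (G : SimpleGraph V) (c : Sym2 V → ℝ)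
    (e : Sym2 V) : ℝ :=
  (∑ T ∈ (spanningTrees G).filter (fun T => e ∈ T), ∏ t ∈ T, c t) /
    (∑ T ∈ spanningTrees G, ∏ t ∈ T, c t)

/-- The resistance curvature `p_v(c) = 1 - (1/2) ∑_{uv ∈ E} r_{uv}(c)`. -/
noncomputable def curvature [Fintype V] (G : SimpleGraph V) (c : Sym2 V → ℝ) (v : V) : ℝ :=
  1 - (1 / 2) * ∑ u ∈ Finset.univ.filter (fun u => G.Adj u v), relativeResistance G c s(u, v)

/-- `G` is resistance nonnegative (RN): some positive weights give `p ≥ 0` at every vertex. -/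
def IsRN [Fintype V] (G : SimpleGraph V) : Prop :=
  ∃ c : Sym2 V → ℝ, IsPositiveWeight G c ∧ ∀ v, 0 ≤ curvature G c v

/-- `G` is resistance positive (RP): some positive weights give `p > 0` at every vertex. -/
def IsRP [Fintype V] (G : SimpleGraph V) : Prop :=
  ∃ c : Sym2 V → ℝ, IsPositiveWeight G c ∧ ∀ v, 0 < curvature G c v

/-- Adjacency in the circle inversion: `none` is the new vertex. -/
def cinvAdj [Fintype V] (G : SimpleGraph V) (c : Sym2 V → ℝ) (x : V) :
    Option {v : V // v ≠ x} → Option {v : V // v ≠ x} → Prop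
  | some u, some v => G.Adj u.1 v.1
  | none, some y => 0 < curvature G c y.1
  | some y, none => 0 < curvature G c y.1
  | none, none => False

/-- The circle inversion of `(G, c)` over `x` (meant for weights with `p(c) ≥ 0`): remove the vertex
`x`, and add a new vertex, `none`, that is adjacent to exactly the remaining vertices `y` with
`p_y(c) > 0`, the curvature being that of `G` with weights `c`. -/
def cinv [Fintype V] (G : SimpleGraph V) (c : Sym2 V → ℝ) (x : V) :
    SimpleGraph (Option {v : V // v ≠ x}) where
  Adj := cinvAdj G c x
  symm := ⟨by
    rintro (_ | u) (_ | v) h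
    · exact h
    · exact h
    · exact h
    · exact G.adj_symm h⟩
  loopless := ⟨by
    rintro (_ | u) h
    · exact h
    · exact G.loopless.irrefl _ h⟩

end

end ResistanceGraph

/-!
The proof rests on one matrix identity. Let `L` be the weighted Laplacian of a connected graph with
positive weights, `Ω` its matrix of effective resistances, and `p` its vector of resistance
curvatures. Then `Ω` is symmetric with zero diagonal and `Ω L = 2 (1 pᵀ - I)`; moreover `Ω` and `p`
are determined by `L` (`IsResistanceMatrix`, `IsResistanceMatrix.curvature_unique`). Together with
`1ᵀ p = 1` and the constancy of `Ω p`, the identity says that the bordered matrices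
`[0, 1ᵀ; 1, Ω]` and `[-s, pᵀ; p, -L/2]`, for a suitable scalar `s`, are inverse to each other.

The identity is proved by counting (`sum_conductance_mul_separatingWeight`). Up to the weighted
number of spanning trees, `Ω u v` is the weighted number of spanning forests with two components
that separate `u` from `v`. Adding an edge at `v` that joins the two components turns such a forest
into a spanning tree, and each tree `T` then contributes to the `(u, v)` entry of `Ω L` its weight
times `2 - deg_T v` if `u ≠ v`, because exactly one edge of `T` at `v` leads towards `u`, and its
weight times `-deg_T v` if `u = v`. Finally `2 - 2 p v` is the mean degree of `v` in a random
spanning tree.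

Inversion over `x` exchanges `x` with the border index and rescales every other index `y` by
`Ω x y`, which keeps the two bordered matrices inverse to each other
(`IsResistanceMatrix.inversion`). Reading off the blocks, the inverted graph carries the weights
`c_yz (Ω x y) (Ω x z)` on its old edges and `2 (p y) (Ω x y)` on the edge from the new vertex to `y`,
and its curvature is `p x` at the new vertex and `c_xy (Ω x y) / 2` at `y`, where `c_xy = 0` if `y`
is not adjacent to `x`. These curvatures are nonnegative, and positive if `p x > 0` and `x` is
adjacent to all other vertices. Connectedness comes for free: by the identity every vector in the
kernel of `L` is constant (`IsResistanceMatrix.connected`).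
-/

namespace ResistanceGraph

/-! ### Spanning trees and two-component forests -/

section Combinatorics

open Classical

variable {V : Type*} {G : SimpleGraph V}

/-- The spanning subgraph formed by a finite set of edges. -/
abbrev edgeGraph (T : Finset (Sym2 V)) : SimpleGraph V :=
  SimpleGraph.fromEdgeSet (T : Set (Sym2 V))

lemma edgeGraph_adj {T : Finset (Sym2 V)} {v w : V} :
    (edgeGraph T).Adj v w ↔ s(v, w) ∈ T ∧ v ≠ w := by
  simp [edgeGraph]

lemma edgeGraph_mono {S T : Finset (Sym2 V)} (h : S ⊆ T) : edgeGraph S ≤ edgeGraph T :=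
  SimpleGraph.fromEdgeSet_mono (by exact_mod_cast h)

lemma edgeGraph_erase (T : Finset (Sym2 V)) (e : Sym2 V) :
    edgeGraph (T.erase e) = (edgeGraph T).deleteEdges {e} := by
  ext v w
  simp only [edgeGraph_adj, SimpleGraph.deleteEdges_adj, Finset.mem_erase, Set.mem_singleton_iff]
  tauto

lemma edgeGraph_insert (F : Finset (Sym2 V)) (v w : V) :
    edgeGraph (insert s(v, w) F) = edgeGraph F ⊔ SimpleGraph.edge v w := by
  ext a b
  simp only [edgeGraph_adj, SimpleGraph.sup_adj, SimpleGraph.edge_adj, Finset.mem_insert,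
    Sym2.eq_iff]
  tauto

/-- In a connected graph, the inclusion-maximal acyclic edge sets are the edge sets of the
spanning subgraphs that are trees. -/
lemma isSpanningTree_iff [Finite V] (hG : G.Connected) {T : Finset (Sym2 V)} :
    IsSpanningTree G T ↔ (∀ e ∈ T, e ∈ G.edgeSet) ∧ (edgeGraph T).IsTree := by
  have hle : ∀ {S : Finset (Sym2 V)}, (∀ e ∈ S, e ∈ G.edgeSet) → edgeGraph S ≤ G := by
    intro S hS v w h
    exact hS _ (edgeGraph_adj.1 h).1
  have hsub : ∀ {S S' : Finset (Sym2 V)}, (∀ e ∈ S, e ∈ G.edgeSet) →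
      edgeGraph S ≤ edgeGraph S' → S ⊆ S' := by
    intro S S' hS h e
    induction e with
    | _ v w => exact fun he => (edgeGraph_adj.1 (h (edgeGraph_adj.2 ⟨he, (hS _ he).ne⟩))).1
  constructor
  · intro h
    refine ⟨h.1.1, ?_⟩
    obtain ⟨F, hTF, hFG, hF⟩ := hG.exists_isTree_le_of_le_of_isAcyclic (hle h.1.1) h.1.2
    have hfin : F.edgeSet.Finite := Set.toFinite _
    have hFeq : edgeGraph hfin.toFinset = F := by simp [edgeGraph]
    have hmem : ∀ e ∈ hfin.toFinset, e ∈ G.edgeSet := fun e he =>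
      SimpleGraph.edgeSet_mono hFG (hfin.mem_toFinset.1 he)
    have h1 : T ⊆ hfin.toFinset := hsub h.1.1 (by rwa [hFeq])
    have h2 : hfin.toFinset ⊆ T :=
      h.2 ⟨hmem, by change (edgeGraph hfin.toFinset).IsAcyclic; rw [hFeq]; exact hF.isAcyclic⟩ h1
    rw [h1.antisymm h2, hFeq]
    exact hF
  · rintro ⟨hT, hTree⟩
    refine ⟨⟨hT, hTree.isAcyclic⟩, fun S hS hTS => hsub hS.1 ?_⟩
    exact ((hG.maximal_le_isAcyclic_iff_isTree (hle hT)).2 hTree).2 ⟨hle hS.1, hS.2⟩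
      (edgeGraph_mono hTS)

/-- An acyclic set of edges of `G` whose spanning subgraph has exactly two components. -/
def IsTwoForest (G : SimpleGraph V) (F : Finset (Sym2 V)) : Prop :=
  IsAcyclicEdgeSet G F ∧ ∃ a b, ¬ (edgeGraph F).Reachable a b ∧
    ∀ u, (edgeGraph F).Reachable a u ∨ (edgeGraph F).Reachable b u

lemma not_reachable_erase {T : Finset (Sym2 V)} (hT : (edgeGraph T).IsTree) {v w : V}
    (hvw : (edgeGraph T).Adj v w) : ¬ (edgeGraph (T.erase s(v, w))).Reachable v w := by
  rw [edgeGraph_erase]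
  exact SimpleGraph.isBridge_iff.1
    (SimpleGraph.isAcyclic_iff_forall_adj_isBridge.1 hT.isAcyclic hvw)

lemma reachable_erase_or {T : Finset (Sym2 V)} (hT : (edgeGraph T).IsTree) (v w u : V) :
    (edgeGraph (T.erase s(v, w))).Reachable v u ∨
      (edgeGraph (T.erase s(v, w))).Reachable w u := by
  have h := hT.connected v u
  rw [SimpleGraph.reachable_iff_reflTransGen] at h
  induction h with
  | refl => exact Or.inl (SimpleGraph.Reachable.refl _)
  | @tail b u _ hbu ih =>
    by_cases he : s(b, u) = s(v, w)
    · rcases Sym2.eq_iff.1 he with ⟨_, rfl⟩ | ⟨_, rfl⟩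
      · exact Or.inr (SimpleGraph.Reachable.refl _)
      · exact Or.inl (SimpleGraph.Reachable.refl _)
    · have hadj : (edgeGraph (T.erase s(v, w))).Adj b u := by
        rw [edgeGraph_adj] at hbu ⊢
        exact ⟨Finset.mem_erase.2 ⟨he, hbu.1⟩, hbu.2⟩
      exact ih.imp (fun h => h.trans hadj.reachable) (fun h => h.trans hadj.reachable)

lemma IsSpanningTree.isTwoForest_erase [Finite V] (hG : G.Connected) {T : Finset (Sym2 V)}
    (hT : IsSpanningTree G T) {v w : V} (he : s(v, w) ∈ T) :
    IsTwoForest G (T.erase s(v, w)) := by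
  obtain ⟨hTG, htree⟩ := (isSpanningTree_iff hG).1 hT
  have hadj : (edgeGraph T).Adj v w := edgeGraph_adj.2 ⟨he, (hTG _ he).ne⟩
  exact ⟨⟨fun e h => hTG e (Finset.mem_of_mem_erase h),
    htree.isAcyclic.anti (edgeGraph_mono (Finset.erase_subset _ _))⟩,
    v, w, not_reachable_erase htree hadj, reachable_erase_or htree v w⟩

lemma IsTwoForest.isSpanningTree_insert [Finite V] (hG : G.Connected) {F : Finset (Sym2 V)}
    (hF : IsTwoForest G F) {v w : V} (hvw : G.Adj v w) (hr : ¬ (edgeGraph F).Reachable v w) :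
    IsSpanningTree G (insert s(v, w) F) := by
  obtain ⟨⟨hFG, hac⟩, a, b, -, hcov⟩ := hF
  rw [isSpanningTree_iff hG]
  refine ⟨fun e he => ?_, ?_, ?_⟩
  · rcases Finset.mem_insert.1 he with rfl | he
    · exact hvw
    · exact hFG e he
  · have hle : edgeGraph F ≤ edgeGraph (insert s(v, w) F) :=
      edgeGraph_mono (Finset.subset_insert _ _)
    have hadj : (edgeGraph (insert s(v, w) F)).Reachable v w :=
      (edgeGraph_adj.2 ⟨Finset.mem_insert_self _ _, hvw.ne⟩ :
        (edgeGraph (insert s(v, w) F)).Adj v w).reachable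
    have key : ∀ u, (edgeGraph (insert s(v, w) F)).Reachable v u := by
      intro u
      -- Of the two components, one contains `v` and the other contains `w`.
      have hor : (edgeGraph F).Reachable v u ∨ (edgeGraph F).Reachable w u := by
        rcases hcov v with hv | hv <;> rcases hcov w with hw | hw
        · exact absurd (hv.symm.trans hw) hr
        · exact (hcov u).imp (fun h => hv.symm.trans h) (fun h => hw.symm.trans h)
        · exact (hcov u).symm.imp (fun h => hv.symm.trans h) (fun h => hw.symm.trans h)
        · exact absurd (hv.symm.trans hw) hr
      rcases hor with h | h
      · exact h.mono hle
      · exact hadj.trans (h.mono hle)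
    exact { preconnected := fun y z => (key y).symm.trans (key z), nonempty := ⟨v⟩ }
  · rw [edgeGraph_insert]
    exact SimpleGraph.IsAcyclic.sup_edge_of_not_reachable hr hac

/-- In a tree, a vertex `u ≠ v` lies beyond exactly one of the edges at `v`. -/
lemma existsUnique_adj_reachable_erase {T : Finset (Sym2 V)} (hT : (edgeGraph T).IsTree) {u v : V}
    (huv : u ≠ v) :
    ∃! w, (edgeGraph T).Adj v w ∧ (edgeGraph (T.erase s(v, w))).Reachable w u := by
  obtain ⟨p, hp, huniq⟩ := hT.existsUnique_path v u
  cases p with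
  | nil => exact absurd rfl huv
  | @cons _ w _ h p' =>
    rw [SimpleGraph.Walk.cons_isPath_iff] at hp
    refine ⟨w, ⟨h, ?_⟩, ?_⟩
    · rw [edgeGraph_erase, SimpleGraph.reachable_deleteEdges_iff_exists_walk]
      exact ⟨p', fun he => hp.2 (p'.fst_mem_support_of_mem_edges he)⟩
    · rintro w' ⟨h', hr'⟩
      obtain ⟨q, hq⟩ := hr'.exists_isPath
      have hle : edgeGraph (T.erase s(v, w')) ≤ edgeGraph T :=
        edgeGraph_mono (Finset.erase_subset _ _)
      have hv : v ∉ q.support := fun hmem =>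
        not_reachable_erase hT h' (q.takeUntil v hmem).reachable.symm
      have hpath : (SimpleGraph.Walk.cons h' (q.mapLe hle)).IsPath := by
        rw [SimpleGraph.Walk.cons_isPath_iff]
        exact ⟨hq.mapLe hle, by simpa using hv⟩
      have := congrArg SimpleGraph.Walk.snd (huniq _ hpath)
      simpa using this

/-- The `(v, w)` entry of the weighted adjacency matrix of `G`. -/
noncomputable def conductance (G : SimpleGraph V) (c : Sym2 V → ℝ) (v w : V) : ℝ :=
  if G.Adj v w then c s(v, w) else 0

lemma conductance_comm (c : Sym2 V → ℝ) (v w : V) : conductance G c v w = conductance G c w v := by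
  simp only [conductance, G.adj_comm v w, Sym2.eq_swap]

lemma conductance_nonneg {c : Sym2 V → ℝ} (hc : IsPositiveWeight G c) (v w : V) :
    0 ≤ conductance G c v w := by
  unfold conductance
  split_ifs with h
  · exact (hc _ h).le
  · exact le_rfl

variable [Fintype V]

lemma mem_spanningTrees {T : Finset (Sym2 V)} : T ∈ spanningTrees G ↔ IsSpanningTree G T := by
  simp [spanningTrees]

/-! ### Weighted counts of trees and forests -/

/-- The weighted number of spanning trees. -/
noncomputable def treeWeight (G : SimpleGraph V) (c : Sym2 V → ℝ) : ℝ :=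
  ∑ T ∈ spanningTrees G, ∏ t ∈ T, c t

lemma treeWeight_pos (hG : G.Connected) {c : Sym2 V → ℝ} (hc : IsPositiveWeight G c) :
    0 < treeWeight G c := by
  refine Finset.sum_pos (fun T hT => Finset.prod_pos fun e he =>
    hc e ((mem_spanningTrees.1 hT).1.1 e he)) ?_
  obtain ⟨F, hFG, hF⟩ := hG.exists_isTree_le
  have hfin : F.edgeSet.Finite := Set.toFinite _
  refine ⟨hfin.toFinset, mem_spanningTrees.2 ((isSpanningTree_iff hG).2 ⟨fun e he =>
    SimpleGraph.edgeSet_mono hFG (hfin.mem_toFinset.1 he), ?_⟩)⟩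
  simpa [edgeGraph] using hF

/-- The weighted number of two-component spanning forests that separate `u` from `v`. Divided by
`treeWeight G c`, it is the effective resistance between `u` and `v`. -/
noncomputable def separatingWeight (G : SimpleGraph V) (c : Sym2 V → ℝ) (u v : V) : ℝ :=
  ∑ F ∈ Finset.univ.filter (IsTwoForest G),
    (∏ t ∈ F, c t) * if (edgeGraph F).Reachable u v then 0 else 1

lemma separatingWeight_self (c : Sym2 V → ℝ) (u : V) : separatingWeight G c u u = 0 := by
  simp [separatingWeight]

lemma separatingWeight_comm (c : Sym2 V → ℝ) (u v : V) :
    separatingWeight G c u v = separatingWeight G c v u := by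
  simp only [separatingWeight, SimpleGraph.reachable_comm]

/-- Removing the edge `vw` matches the spanning trees through `vw` with the two-component forests
separating `v` from `w`. -/
lemma sum_isTwoForest_eq_sum_spanningTrees (hG : G.Connected) (c : Sym2 V → ℝ) {v w : V}
    (hvw : G.Adj v w) (φ : Finset (Sym2 V) → ℝ) :
    ∑ F ∈ (Finset.univ.filter (IsTwoForest G)).filter
        (fun F => ¬ (edgeGraph F).Reachable v w), c s(v, w) * (∏ t ∈ F, c t) * φ F =
      ∑ T ∈ (spanningTrees G).filter (fun T => s(v, w) ∈ T),
        (∏ t ∈ T, c t) * φ (T.erase s(v, w)) := by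
  have hnot : ∀ F : Finset (Sym2 V), ¬ (edgeGraph F).Reachable v w → s(v, w) ∉ F :=
    fun F hF he => hF (edgeGraph_adj.2 ⟨he, hvw.ne⟩ : (edgeGraph F).Adj v w).reachable
  refine Finset.sum_bij' (fun F _ => insert s(v, w) F) (fun T _ => T.erase s(v, w)) ?_ ?_ ?_ ?_ ?_
  · intro F hF
    simp only [Finset.mem_filter, Finset.mem_univ, true_and] at hF
    exact Finset.mem_filter.2 ⟨mem_spanningTrees.2 (hF.1.isSpanningTree_insert hG hvw hF.2),
      Finset.mem_insert_self _ _⟩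
  · intro T hT
    rw [Finset.mem_filter, mem_spanningTrees] at hT
    simp only [Finset.mem_filter, Finset.mem_univ, true_and]
    exact ⟨hT.1.isTwoForest_erase hG hT.2, not_reachable_erase ((isSpanningTree_iff hG).1 hT.1).2
      (edgeGraph_adj.2 ⟨hT.2, hvw.ne⟩)⟩
  · intro F hF
    exact Finset.erase_insert (hnot F (Finset.mem_filter.1 hF).2)
  · intro T hT
    exact Finset.insert_erase (Finset.mem_filter.1 hT).2
  · intro F hF
    have h := hnot F (Finset.mem_filter.1 hF).2
    rw [Finset.erase_insert h, Finset.prod_insert h]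

/-- Up to its weight, a tree in which `v` has degree `d` contributes `1 - (d - 1)` to the Laplacian
of the separating weights `separatingWeight G c u` at `v`, for a vertex `u ≠ v`, since `u` lies
beyond exactly one edge at `v`; for `u = v` it contributes `-d`. -/
lemma sum_tree_incidence {T : Finset (Sym2 V)} (hTG : ∀ e ∈ T, e ∈ G.edgeSet)
    (hT : (edgeGraph T).IsTree) (u v : V) :
    ∑ w ∈ Finset.univ.filter (fun w => s(v, w) ∈ T),
        ((if (edgeGraph (T.erase s(v, w))).Reachable u v then (0 : ℝ) else 1) -
          if (edgeGraph (T.erase s(v, w))).Reachable u w then 0 else 1) =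
      2 - (if u = v then 2 else 0) - (Finset.univ.filter (fun w => s(v, w) ∈ T)).card := by
  have hadj : ∀ w, s(v, w) ∈ T ↔ (edgeGraph T).Adj v w := fun w =>
    ⟨fun h => edgeGraph_adj.2 ⟨h, (hTG _ h).ne⟩, fun h => (edgeGraph_adj.1 h).1⟩
  have hterm : ∀ w ∈ Finset.univ.filter (fun w => s(v, w) ∈ T),
      ((if (edgeGraph (T.erase s(v, w))).Reachable u v then (0 : ℝ) else 1) -
          if (edgeGraph (T.erase s(v, w))).Reachable u w then 0 else 1) =
        2 * (if (edgeGraph (T.erase s(v, w))).Reachable w u then 1 else 0) - 1 := by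
    intro w hw
    have hnr := not_reachable_erase hT ((hadj w).1 (Finset.mem_filter.1 hw).2)
    rcases reachable_erase_or hT v w u with h | h
    · have h' : ¬ (edgeGraph (T.erase s(v, w))).Reachable w u := fun h' => hnr (h.trans h'.symm)
      rw [if_pos h.symm, if_neg fun k => h' k.symm, if_neg h']; norm_num
    · have h' : ¬ (edgeGraph (T.erase s(v, w))).Reachable v u := fun h' => hnr (h'.trans h.symm)
      rw [if_neg fun k => h' k.symm, if_pos h.symm, if_pos h]; norm_num
  rw [Finset.sum_congr rfl hterm, Finset.sum_sub_distrib, ← Finset.mul_sum, Finset.sum_boole,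
    Finset.filter_filter, Finset.sum_const, nsmul_eq_mul, mul_one]
  congr 1
  by_cases huv : u = v
  · subst huv
    rw [if_pos rfl, Finset.filter_eq_empty_iff.2]
    · simp
    · rintro w - ⟨h1, h2⟩
      exact not_reachable_erase hT ((hadj w).1 h1) h2.symm
  · obtain ⟨w₀, hw₀, huniq⟩ := existsUnique_adj_reachable_erase hT huv
    have : Finset.univ.filter (fun w => s(v, w) ∈ T ∧
        (edgeGraph (T.erase s(v, w))).Reachable w u) = {w₀} := by
      ext w
      simp only [Finset.mem_filter, Finset.mem_univ, true_and, Finset.mem_singleton, hadj]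
      exact ⟨fun h => huniq w h, fun h => h ▸ hw₀⟩
    rw [this, if_neg huv]; simp

/-- The curvature at `v` is one minus half the expected degree of `v` in a random spanning tree. -/
lemma sum_prod_mul_degree (hG : G.Connected) {c : Sym2 V → ℝ} (hc : IsPositiveWeight G c) (v : V) :
    ∑ T ∈ spanningTrees G,
        (∏ t ∈ T, c t) * ((Finset.univ.filter (fun w => s(v, w) ∈ T)).card : ℝ) =
      treeWeight G c * (2 - 2 * curvature G c v) := by
  have hZ := (treeWeight_pos hG hc).ne'
  have h1 : treeWeight G c * (2 - 2 * curvature G c v) =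
      ∑ u ∈ Finset.univ.filter (fun u => G.Adj u v),
        ∑ T ∈ (spanningTrees G).filter (fun T => s(u, v) ∈ T), ∏ t ∈ T, c t := by
    unfold curvature relativeResistance
    rw [← Finset.sum_div]
    change treeWeight G c * (2 - 2 * (1 - 1 / 2 * (_ / treeWeight G c))) = _
    field_simp
    ring
  rw [h1, Finset.sum_filter]
  have h2 : ∀ u, (if G.Adj u v then
      ∑ T ∈ (spanningTrees G).filter (fun T => s(u, v) ∈ T), ∏ t ∈ T, c t else 0) =
      ∑ T ∈ spanningTrees G, if s(v, u) ∈ T then ∏ t ∈ T, c t else 0 := by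
    intro u
    rw [Finset.sum_filter, Sym2.eq_swap]
    split_ifs with h
    · rfl
    · refine (Finset.sum_eq_zero fun T hT => if_neg fun hm => h ?_).symm
      exact ((mem_spanningTrees.1 hT).1.1 _ hm).symm
  rw [Finset.sum_congr rfl fun u _ => h2 u, Finset.sum_comm]
  refine Finset.sum_congr rfl fun T _ => ?_
  rw [← Finset.sum_filter, Finset.sum_const, nsmul_eq_mul, mul_comm]

/-- Applying the weighted Laplacian to the separating weights. -/
lemma sum_conductance_mul_separatingWeight (hG : G.Connected) {c : Sym2 V → ℝ}
    (hc : IsPositiveWeight G c) (u v : V) :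
    ∑ w, conductance G c v w * (separatingWeight G c u v - separatingWeight G c u w) =
      treeWeight G c * (2 * curvature G c v - if u = v then 2 else 0) := by
  have h1 : ∀ w, conductance G c v w * (separatingWeight G c u v - separatingWeight G c u w) =
      ∑ T ∈ spanningTrees G, if s(v, w) ∈ T then (∏ t ∈ T, c t) *
        ((if (edgeGraph (T.erase s(v, w))).Reachable u v then (0 : ℝ) else 1) -
          if (edgeGraph (T.erase s(v, w))).Reachable u w then 0 else 1) else 0 := by
    intro w
    by_cases hvw : G.Adj v w
    · rw [← Finset.sum_filter, ← sum_isTwoForest_eq_sum_spanningTrees hG c hvw fun F =>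
        (if (edgeGraph F).Reachable u v then (0 : ℝ) else 1) -
          if (edgeGraph F).Reachable u w then 0 else 1]
      rw [conductance, if_pos hvw, separatingWeight, separatingWeight, ← Finset.sum_sub_distrib,
        Finset.mul_sum, Finset.sum_filter_of_ne (s := Finset.univ.filter (IsTwoForest G))]
      · exact Finset.sum_congr rfl fun F _ => by ring
      · intro F _ hne hr
        refine hne ?_
        have : (edgeGraph F).Reachable u v ↔ (edgeGraph F).Reachable u w :=
          ⟨fun h => h.trans hr, fun h => h.trans hr.symm⟩
        simp [this]
    · rw [conductance, if_neg hvw, zero_mul]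
      refine (Finset.sum_eq_zero fun T hT => if_neg fun hm => hvw ?_).symm
      exact (mem_spanningTrees.1 hT).1.1 _ hm
  rw [Finset.sum_congr rfl fun w _ => h1 w, Finset.sum_comm]
  have h2 : ∀ T ∈ spanningTrees G, (∑ w, if s(v, w) ∈ T then (∏ t ∈ T, c t) *
        ((if (edgeGraph (T.erase s(v, w))).Reachable u v then (0 : ℝ) else 1) -
          if (edgeGraph (T.erase s(v, w))).Reachable u w then 0 else 1) else 0) =
      (∏ t ∈ T, c t) * (2 - (if u = v then 2 else 0)) -
        (∏ t ∈ T, c t) * ((Finset.univ.filter (fun w => s(v, w) ∈ T)).card : ℝ) := by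
    intro T hT
    have := (isSpanningTree_iff hG).1 (mem_spanningTrees.1 hT)
    rw [← Finset.sum_filter, ← Finset.mul_sum, sum_tree_incidence this.1 this.2, mul_sub]
  rw [Finset.sum_congr rfl h2, Finset.sum_sub_distrib, sum_prod_mul_degree hG hc,
    ← Finset.sum_mul, ← treeWeight]
  ring

end Combinatorics

/-! ### Resistance matrices -/

section Fiedler

variable {V : Type*} [Fintype V] {a Ω : V → V → ℝ} {p : V → ℝ}

/-- `Ω` is a resistance matrix with curvature vector `p` for the symmetric conductances `a`: it is
symmetric with zero diagonal, and `Ω L = 2 (1 pᵀ - I)`, where `L` is the Laplacian of `a`, whose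
product with `Ω` is written out entrywise. -/
structure IsResistanceMatrix [DecidableEq V] (a Ω : V → V → ℝ) (p : V → ℝ) : Prop where
  diag : ∀ u, Ω u u = 0
  symm : ∀ u v, Ω u v = Ω v u
  mul_laplacian : ∀ u v, ∑ w, a v w * (Ω u v - Ω u w) = 2 * p v - if u = v then 2 else 0

/-- The Laplacian of symmetric conductances is a symmetric operator. -/
lemma sum_mul_laplacian_comm (ha : ∀ v w, a v w = a w v) (f g : V → ℝ) :
    ∑ v, f v * ∑ w, a v w * (g v - g w) = ∑ v, g v * ∑ w, a v w * (f v - f w) := by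
  have h : ∀ f g : V → ℝ, ∑ v, f v * ∑ w, a v w * (g v - g w) =
      ∑ v, ∑ w, a v w * (f v * g v) - ∑ v, ∑ w, a v w * (f v * g w) := by
    intro f g
    rw [← Finset.sum_sub_distrib]
    refine Finset.sum_congr rfl fun v _ => ?_
    rw [← Finset.sum_sub_distrib, Finset.mul_sum]
    exact Finset.sum_congr rfl fun w _ => by ring
  rw [h, h]
  congr 1
  · exact Finset.sum_congr rfl fun v _ => Finset.sum_congr rfl fun w _ => by ring
  · rw [Finset.sum_comm]
    exact Finset.sum_congr rfl fun v _ => Finset.sum_congr rfl fun w _ => by rw [ha]; ring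

/-- The quadratic form of the Laplacian is the Dirichlet energy. -/
lemma two_mul_sum_mul_laplacian (ha : ∀ v w, a v w = a w v) (f : V → ℝ) :
    2 * ∑ v, f v * ∑ w, a v w * (f v - f w) = ∑ v, ∑ w, a v w * (f v - f w) ^ 2 := by
  have h : ∑ v, f v * ∑ w, a v w * (f v - f w) = ∑ v, ∑ w, a v w * (f v - f w) * f v :=
    Finset.sum_congr rfl fun v _ => by rw [mul_comm, Finset.sum_mul]
  have h' : ∑ v, ∑ w, a v w * (f v - f w) * f v = ∑ v, ∑ w, a v w * (f v - f w) * (-f w) := by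
    rw [Finset.sum_comm]
    exact Finset.sum_congr rfl fun v _ => Finset.sum_congr rfl fun w _ => by rw [ha]; ring
  rw [two_mul, h]
  nth_rewrite 2 [h']
  rw [← Finset.sum_add_distrib]
  refine Finset.sum_congr rfl fun v _ => ?_
  rw [← Finset.sum_add_distrib]
  exact Finset.sum_congr rfl fun w _ => by ring

/-- If the Dirichlet energy of the potential `f` vanishes, no current flows along any edge. -/
lemma term_eq_zero_of_energy_le (ha : ∀ v w, a v w = a w v) (hnn : ∀ v w, 0 ≤ a v w) {f : V → ℝ}
    (h : ∑ v, f v * ∑ w, a v w * (f v - f w) ≤ 0) (v w : V) : a v w * (f v - f w) = 0 := by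
  have hE := two_mul_sum_mul_laplacian ha f
  have hterm : ∀ v w, 0 ≤ a v w * (f v - f w) ^ 2 := fun v w =>
    mul_nonneg (hnn v w) (sq_nonneg _)
  have h0 : ∑ v, ∑ w, a v w * (f v - f w) ^ 2 = 0 :=
    le_antisymm (by linarith)
      (Finset.sum_nonneg fun v _ => Finset.sum_nonneg fun w _ => hterm v w)
  have h1 := (Finset.sum_eq_zero_iff_of_nonneg
    fun v _ => Finset.sum_nonneg fun w _ => hterm v w).1 h0 v (Finset.mem_univ _)
  have h2 := (Finset.sum_eq_zero_iff_of_nonneg fun w _ => hterm v w).1 h1 w (Finset.mem_univ _)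
  rcases mul_eq_zero.1 h2 with h3 | h3
  · rw [h3, zero_mul]
  · rw [pow_eq_zero_iff two_ne_zero |>.1 h3, mul_zero]

variable [DecidableEq V]

namespace IsResistanceMatrix

/-- The Laplacian of a resistance matrix has only constants in its kernel: multiply a kernel
vector by `Ω L = 2 (1 pᵀ - I)`. -/
lemma eq_const_of_harmonic (hΩ : IsResistanceMatrix a Ω p) (ha : ∀ v w, a v w = a w v) {f : V → ℝ}
    (hf : ∀ v, ∑ w, a v w * (f v - f w) = 0) (u : V) : f u = ∑ v, p v * f v := by
  have h := sum_mul_laplacian_comm ha f (Ω u)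
  simp only [hf, mul_zero, Finset.sum_const_zero, hΩ.mul_laplacian] at h
  simp only [mul_sub, Finset.sum_sub_distrib, mul_ite, mul_zero, Finset.sum_ite_eq,
    Finset.mem_univ, if_true] at h
  have h2 : ∑ v, f v * (2 * p v) = 2 * ∑ v, p v * f v := by
    rw [Finset.mul_sum]
    exact Finset.sum_congr rfl fun v _ => by ring
  linarith

lemma eq_of_harmonic (hΩ : IsResistanceMatrix a Ω p) (ha : ∀ v w, a v w = a w v) {f : V → ℝ}
    (hf : ∀ v, ∑ w, a v w * (f v - f w) = 0) (u v : V) : f u = f v :=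
  (hΩ.eq_const_of_harmonic ha hf u).trans (hΩ.eq_const_of_harmonic ha hf v).symm

lemma sum_curvature [Nonempty V] (hΩ : IsResistanceMatrix a Ω p) (ha : ∀ v w, a v w = a w v) :
    ∑ v, p v = 1 := by
  have h := hΩ.eq_const_of_harmonic ha (f := fun _ => 1) (by simp) (Classical.arbitrary V)
  simpa using h.symm

/-- All vertices have the same curvature-weighted mean resistance, because `Ω p` is harmonic. -/
lemma sum_mul_curvature_eq (hΩ : IsResistanceMatrix a Ω p) (ha : ∀ v w, a v w = a w v) (u v : V) :
    ∑ k, Ω u k * p k = ∑ k, Ω v k * p k := by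
  have : Nonempty V := ⟨u⟩
  refine hΩ.eq_of_harmonic ha (f := fun v => ∑ k, Ω v k * p k) (fun v => ?_) u v
  have h1 : ∀ w, a v w * (∑ k, Ω v k * p k - ∑ k, Ω w k * p k) =
      ∑ k, p k * (a v w * (Ω k v - Ω k w)) := by
    intro w
    rw [← Finset.sum_sub_distrib, Finset.mul_sum]
    exact Finset.sum_congr rfl fun k _ => by rw [hΩ.symm v k, hΩ.symm w k]; ring
  rw [Finset.sum_congr rfl fun w _ => h1 w, Finset.sum_comm]
  simp only [← Finset.mul_sum, hΩ.mul_laplacian]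
  simp only [mul_sub, Finset.sum_sub_distrib, mul_ite, mul_zero, Finset.sum_ite_eq',
    Finset.mem_univ, if_true]
  rw [← Finset.sum_mul, hΩ.sum_curvature ha]
  ring

/-- The resistance between distinct vertices is positive: `4 Ω x y` is the Dirichlet energy of the
potential `Ω y - Ω x`. -/
lemma pos (hΩ : IsResistanceMatrix a Ω p) (ha : ∀ v w, a v w = a w v) (hnn : ∀ v w, 0 ≤ a v w)
    {x y : V} (hxy : x ≠ y) : 0 < Ω x y := by
  have hL : ∀ v, ∑ w, a v w * ((Ω y v - Ω x v) - (Ω y w - Ω x w)) =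
      (if x = v then 2 else 0) - if y = v then 2 else 0 := by
    intro v
    have h1 : ∀ w, a v w * ((Ω y v - Ω x v) - (Ω y w - Ω x w)) =
        a v w * (Ω y v - Ω y w) - a v w * (Ω x v - Ω x w) := fun w => by ring
    rw [Finset.sum_congr rfl fun w _ => h1 w, Finset.sum_sub_distrib, hΩ.mul_laplacian,
      hΩ.mul_laplacian]
    ring
  by_contra hle
  have h0 : ∑ v, (Ω y v - Ω x v) * ∑ w, a v w * ((Ω y v - Ω x v) - (Ω y w - Ω x w)) ≤ 0 := by
    simp only [hL]
    simp only [mul_sub, Finset.sum_sub_distrib, mul_ite, mul_zero, Finset.sum_ite_eq,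
      Finset.mem_univ, if_true, hΩ.diag, hΩ.symm y x]
    linarith
  have h := hL x
  rw [Finset.sum_eq_zero fun w _ => term_eq_zero_of_energy_le ha hnn h0 x w] at h
  simp [hxy.symm] at h

/-- Symmetric conductances have at most one resistance matrix, hence at most one curvature
vector. -/
lemma curvature_unique {Ω' : V → V → ℝ} {p' : V → ℝ} (hΩ : IsResistanceMatrix a Ω p)
    (hΩ' : IsResistanceMatrix a Ω' p') (ha : ∀ v w, a v w = a w v) : p = p' := by
  -- The difference of two rows of `Ω - Ω'` is harmonic, so `Ω - Ω'` has entries `f u + g v`.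
  have hrow : ∀ u u' v v', (Ω u v - Ω' u v) - (Ω u' v - Ω' u' v) =
      (Ω u v' - Ω' u v') - (Ω u' v' - Ω' u' v') := by
    intro u u' v v'
    refine hΩ.eq_of_harmonic ha
      (f := fun v => (Ω u v - Ω' u v) - (Ω u' v - Ω' u' v)) (fun v => ?_) v v'
    have h1 : ∀ w, a v w * ((Ω u v - Ω' u v) - (Ω u' v - Ω' u' v) -
        ((Ω u w - Ω' u w) - (Ω u' w - Ω' u' w))) =
        a v w * (Ω u v - Ω u w) - a v w * (Ω' u v - Ω' u w) -
          (a v w * (Ω u' v - Ω u' w) - a v w * (Ω' u' v - Ω' u' w)) := fun w => by ring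
    rw [Finset.sum_congr rfl fun w _ => h1 w]
    simp only [Finset.sum_sub_distrib, hΩ.mul_laplacian, hΩ'.mul_laplacian]
    ring
  have hEq : ∀ u v, Ω u v = Ω' u v := by
    intro u v
    have h := hrow u v u v
    rw [hΩ.diag, hΩ'.diag, hΩ.diag, hΩ'.diag, hΩ.symm v u, hΩ'.symm v u] at h
    linarith
  funext v
  have h := hΩ.mul_laplacian v v
  have h' := hΩ'.mul_laplacian v v
  simp only [hEq, if_true] at h h'
  linarith

/-- A graph supporting conductances with a resistance matrix is connected, since indicators of
components are harmonic. -/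
lemma connected {G : SimpleGraph V} [Nonempty V] (hΩ : IsResistanceMatrix a Ω p)
    (ha : ∀ v w, a v w = a w v) (hG : ∀ v w, ¬ G.Adj v w → a v w = 0) : G.Connected := by
  classical
  refine { preconnected := fun x y => ?_ }
  have h := hΩ.eq_of_harmonic ha (f := fun v => if G.Reachable x v then 1 else 0)
    (fun v => Finset.sum_eq_zero fun w _ => ?_) x y
  · by_contra hxy
    simp [hxy] at h
  · by_cases hvw : G.Adj v w
    · have : G.Reachable x v ↔ G.Reachable x w :=
        ⟨fun h => h.trans hvw.reachable, fun h => h.trans hvw.reachable.symm⟩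
      simp [this]
    · rw [hG v w hvw, zero_mul]

end IsResistanceMatrix

/-- Effective resistances, as ratios of weighted forest counts, form a resistance matrix whose
curvature vector is the resistance curvature. -/
lemma exists_isResistanceMatrix {G : SimpleGraph V} (hG : G.Connected) {c : Sym2 V → ℝ}
    (hc : IsPositiveWeight G c) :
    ∃ Ω, IsResistanceMatrix (conductance G c) Ω (curvature G c) := by
  have hZ := (treeWeight_pos hG hc).ne'
  refine ⟨fun u v => separatingWeight G c u v / treeWeight G c, fun u => ?_, fun u v => ?_,
    fun u v => ?_⟩
  · simp [separatingWeight_self]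
  · simp only [separatingWeight_comm]
  · have h := sum_conductance_mul_separatingWeight hG hc u v
    simp only [← sub_div, ← mul_div_assoc]
    rw [← Finset.sum_div, h, mul_div_cancel_left₀ _ hZ]
    congr

end Fiedler

/-! ### Inversion of a resistance matrix -/

section Inversion

variable {V : Type*} {x : V}

/-- Conductances of the circle inversion over `x` of conductances `a` with resistance matrix `Ω`
and curvature vector `p`. -/
def invConductance (a Ω : V → V → ℝ) (p : V → ℝ) (x : V) :
    Option {v : V // v ≠ x} → Option {v : V // v ≠ x} → ℝ
  | none, none => 0
  | none, some y => 2 * p y.1 * Ω x y.1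
  | some y, none => 2 * p y.1 * Ω x y.1
  | some y, some z => a y.1 z.1 * (Ω x y.1 * Ω x z.1)

/-- Squared distances after an inversion centred at `x` of points with squared distances `Ω`, the
centre itself being kept as the point `none`. -/
noncomputable def invResistance (Ω : V → V → ℝ) (x : V) :
    Option {v : V // v ≠ x} → Option {v : V // v ≠ x} → ℝ
  | none, none => 0
  | none, some y => (Ω x y.1)⁻¹
  | some y, none => (Ω x y.1)⁻¹
  | some y, some z => Ω y.1 z.1 / (Ω x y.1 * Ω x z.1)

/-- Curvature vector of the circle inversion over `x`. -/
noncomputable def invCurvature (a Ω : V → V → ℝ) (p : V → ℝ) (x : V) :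
    Option {v : V // v ≠ x} → ℝ
  | none => p x
  | some y => a x y.1 * Ω x y.1 / 2

lemma invConductance_comm {a Ω : V → V → ℝ} {p : V → ℝ} (ha : ∀ v w, a v w = a w v)
    (u v : Option {v : V // v ≠ x}) : invConductance a Ω p x u v = invConductance a Ω p x v u := by
  rcases u with _ | u <;> rcases v with _ | v
  · rfl
  · rfl
  · rfl
  · simp only [invConductance]
    rw [ha, mul_comm (Ω x u.1)]

lemma sum_subtype_ne [Fintype V] [DecidableEq V] (f : V → ℝ) :
    ∑ y : {v : V // v ≠ x}, f y.1 = ∑ v, f v - f x := by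
  rw [Fintype.sum_eq_add_sum_subtype_ne f x, add_sub_cancel_left]

/-- Inversion over `x` exchanges `x` with the border index of the bordered matrices
`[0, 1ᵀ; 1, Ω]` and `[*, pᵀ; p, -L/2]`, which are inverse to each other, and rescales the other
indices by the resistances to `x`. Hence the inverted data again satisfy `Ω L = 2 (1 pᵀ - I)`. -/
lemma IsResistanceMatrix.inversion [Fintype V] [DecidableEq V] {a Ω : V → V → ℝ} {p : V → ℝ}
    (hΩ : IsResistanceMatrix a Ω p) (ha : ∀ v w, a v w = a w v)
    (hpos : ∀ y, y ≠ x → 0 < Ω x y) :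
    IsResistanceMatrix (invConductance a Ω p x) (invResistance Ω x) (invCurvature a Ω p x) := by
  have : Nonempty V := ⟨x⟩
  have hne : ∀ y : {v : V // v ≠ x}, Ω x y.1 ≠ 0 := fun y => (hpos y.1 y.2).ne'
  refine ⟨?_, ?_, ?_⟩
  · rintro (_ | u)
    · rfl
    · simp [invResistance, hΩ.diag]
  · rintro (_ | u) (_ | v)
    · rfl
    · rfl
    · rfl
    · simp only [invResistance]
      rw [hΩ.symm, mul_comm (Ω x u.1)]
  · rintro (_ | u) (_ | v)
    · rw [Fintype.sum_option]
      have h1 : ∀ y : {v : V // v ≠ x}, invConductance a Ω p x none (some y) *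
          (invResistance Ω x none none - invResistance Ω x none (some y)) = -2 * p y.1 := by
        intro y
        have := hne y
        simp only [invConductance, invResistance]
        field_simp
        ring
      rw [Finset.sum_congr rfl fun y _ => h1 y, sum_subtype_ne fun v => -2 * p v, ← Finset.mul_sum,
        hΩ.sum_curvature ha]
      simp only [invConductance, invCurvature, if_true]
      ring
    · rw [Fintype.sum_option]
      have hv := hne v
      have h1 : ∀ w : {v : V // v ≠ x}, invConductance a Ω p x (some v) (some w) *
          (invResistance Ω x none (some v) - invResistance Ω x none (some w)) =
            -(a v.1 w.1 * (Ω x v.1 - Ω x w.1)) := by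
        intro w
        have := hne w
        simp only [invConductance, invResistance]
        field_simp
        ring
      rw [Finset.sum_congr rfl fun y _ => h1 y,
        sum_subtype_ne fun w => -(a v.1 w * (Ω x v.1 - Ω x w)), Finset.sum_neg_distrib,
        hΩ.mul_laplacian, if_neg v.2.symm, hΩ.diag, ha v.1 x]
      simp only [invConductance, invResistance, invCurvature, reduceCtorEq, if_false]
      field_simp
      ring
    · rw [Fintype.sum_option]
      have hu := hne u
      have h1 : ∀ y : {v : V // v ≠ x}, invConductance a Ω p x none (some y) *
          (invResistance Ω x (some u) none - invResistance Ω x (some u) (some y)) =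
            2 / Ω x u.1 * (Ω x y.1 * p y.1 - Ω u.1 y.1 * p y.1) := by
        intro y
        have := hne y
        simp only [invConductance, invResistance]
        field_simp
      rw [Finset.sum_congr rfl fun y _ => h1 y,
        sum_subtype_ne fun y => 2 / Ω x u.1 * (Ω x y * p y - Ω u.1 y * p y), ← Finset.mul_sum,
        Finset.sum_sub_distrib, hΩ.sum_mul_curvature_eq ha x u.1, hΩ.diag, hΩ.symm u.1 x]
      simp only [invConductance, invCurvature, reduceCtorEq, if_false]
      field_simp
      ring
    · rw [Fintype.sum_option]
      have hu := hne u
      have hv := hne v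
      have h1 : ∀ w : {v : V // v ≠ x}, invConductance a Ω p x (some v) (some w) *
          (invResistance Ω x (some u) (some v) - invResistance Ω x (some u) (some w)) =
            Ω x v.1 / Ω x u.1 * (a v.1 w.1 * (Ω u.1 v.1 - Ω u.1 w.1)) -
              Ω u.1 v.1 / Ω x u.1 * (a v.1 w.1 * (Ω x v.1 - Ω x w.1)) := by
        intro w
        have := hne w
        simp only [invConductance, invResistance]
        field_simp
        ring
      rw [Finset.sum_congr rfl fun w _ => h1 w,
        sum_subtype_ne fun w => Ω x v.1 / Ω x u.1 * (a v.1 w * (Ω u.1 v.1 - Ω u.1 w)) -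
              Ω u.1 v.1 / Ω x u.1 * (a v.1 w * (Ω x v.1 - Ω x w)), Finset.sum_sub_distrib,
        ← Finset.mul_sum, ← Finset.mul_sum, hΩ.mul_laplacian, hΩ.mul_laplacian, if_neg v.2.symm,
        hΩ.diag, hΩ.symm u.1 x, ha v.1 x]
      simp only [invConductance, invResistance, invCurvature, Option.some_inj]
      by_cases huv : u = v
      · subst huv
        rw [if_pos rfl, if_pos rfl, hΩ.diag]
        field_simp
        ring
      · rw [if_neg huv, if_neg (fun h => huv (Subtype.ext h))]
        field_simp
        ring

end Inversion

end ResistanceGraph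

/-! ### The circle inversion -/

open ResistanceGraph

theorem mainTheorem9 {V : Type*} [Fintype V] [DecidableEq V] (G : SimpleGraph V)
    (hG : G.Connected) (c : Sym2 V → ℝ) (hc : ResistanceGraph.IsPositiveWeight G c)
    (hp : ∀ v, 0 ≤ ResistanceGraph.curvature G c v) (x : V) :
    ((ResistanceGraph.cinv G c x).Connected ∧
      ResistanceGraph.IsRN (ResistanceGraph.cinv G c x)) ∧
    (0 < ResistanceGraph.curvature G c x → (∀ y, y ≠ x → G.Adj x y) →
      ResistanceGraph.IsRP (ResistanceGraph.cinv G c x)) := by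
  obtain ⟨Ω, hΩ⟩ := exists_isResistanceMatrix hG hc
  have ha := conductance_comm (G := G) c
  have hnn := conductance_nonneg hc
  have hpos : ∀ y, y ≠ x → 0 < Ω x y := fun y hy => hΩ.pos ha hnn hy.symm
  have hinv := hΩ.inversion ha hpos
  have hac := invConductance_comm (Ω := Ω) (p := curvature G c) (x := x) ha
  -- The edges of the circle inversion are exactly the pairs of positive inverted conductance.
  have hadj : ∀ u v, (cinv G c x).Adj u v →
      0 < invConductance (conductance G c) Ω (curvature G c) x u v := by
    rintro (_ | u) (_ | v) h
    · exact False.elim h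
    · exact mul_pos (mul_pos two_pos h) (hpos v.1 v.2)
    · exact mul_pos (mul_pos two_pos h) (hpos u.1 u.2)
    · have h' : G.Adj u.1 v.1 := h
      refine mul_pos ?_ (mul_pos (hpos u.1 u.2) (hpos v.1 v.2))
      rw [conductance, if_pos h']
      exact hc _ h'
  have hnadj : ∀ u v, ¬ (cinv G c x).Adj u v →
      invConductance (conductance G c) Ω (curvature G c) x u v = 0 := by
    have hz : ∀ y, ¬ 0 < curvature G c y → curvature G c y = 0 :=
      fun y hy => le_antisymm (not_lt.1 hy) (hp y)
    rintro (_ | u) (_ | v) h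
    · rfl
    · simp [invConductance, hz v.1 h]
    · simp [invConductance, hz u.1 h]
    · have h' : ¬ G.Adj u.1 v.1 := h
      simp [invConductance, conductance, h']
  have hconn := hinv.connected hac hnadj
  let c' : Sym2 (Option {v : V // v ≠ x}) → ℝ :=
    Sym2.lift ⟨invConductance (conductance G c) Ω (curvature G c) x, hac⟩
  have hc' : IsPositiveWeight (cinv G c x) c' := by
    intro e
    induction e with
    | _ u v => exact fun h => hadj u v h
  have hcond : conductance (cinv G c x) c' =
      invConductance (conductance G c) Ω (curvature G c) x := by
    funext u v
    by_cases h : (cinv G c x).Adj u v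
    · rw [conductance, if_pos h]; rfl
    · rw [conductance, if_neg h, hnadj u v h]
  -- The inverted matrix is the resistance matrix of the circle inversion with weights `c'`, so by
  -- uniqueness the resistance curvature of the latter is the inverted curvature vector.
  obtain ⟨Ω', hΩ'⟩ := exists_isResistanceMatrix hconn hc'
  rw [hcond] at hΩ'
  have hcurv := hΩ'.curvature_unique hinv hac
  refine ⟨⟨hconn, c', hc', ?_⟩, fun hx hall => ⟨c', hc', ?_⟩⟩
  · rw [hcurv]
    rintro (_ | y)
    · exact hp x
    · exact div_nonneg (mul_nonneg (hnn _ _) (hpos y.1 y.2).le) two_pos.le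
  · rw [hcurv]
    rintro (_ | y)
    · exact hx
    · refine div_pos (mul_pos ?_ (hpos y.1 y.2)) two_pos
      rw [conductance, if_pos (hall y.1 y.2)]
      exact hc _ (hall y.1 y.2)
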